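/- Let $\gamma>1$ and let $K:[0,\infty)^2\to[0,\infty)$ satisfy $K(v,v')=h(v,v')\,g\big(\tfrac{v}{v+v'}\big)$ for all $(v,v')\neq(0,0)$, where $h\in C([0,\infty)^2)$ is symmetric, $g\in C([0,\infty))$, and: * there are $H>1$ and $H_0>0$ with $h(v,v')\ge H_0(v^\gamma+v'^\gamma)$ whenever $v+v'>H$; * for every $R>0$ there is $C_R>0$ with $h(v,v')\ge C_R$ for all $v,v'\in[\tfrac1R,R]$; * there is $H_1>0$ with $h(v,v')\le H_1(v^\gamma+v'^\gamma)$ for all $v,v'\ge 0$; * $g(x)=g(1-x)$ for all $x\in[0,1]$, $g(\tfrac12)=0$, and there are $G_0,G_1>0$ and a real $k\ge 1$ with $G_0|x-\tfrac12|^k\le g(x)\le G_1$ for all $x\in[0,1]$. Let $f_{\mathrm{in}}$ be a nonnegative Radon measure on $(0,\infty)$ such that $f_{\mathrm{in}}\neq 0$ and $f_{\mathrm{in}}\neq M\delta_V$ for all $M,V\in(0,\infty)$. For $T\in(0,\infty]$, a mass-conserving solution on $[0,T]$ (on $[0,\infty)$ if $T=\infty$) of the coagulation equation $$\partial_t f(v,t)=\frac12\int_{(0,v)}K(v-v',v')f(v-v',t)f(v',t)\,dv'-\int_{(0,\infty)}K(v,v')f(v,t)f(v',t)\,dv'$$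 with initial datum $f_{\mathrm{in}}$ is a family $(f(\cdot,t))_{t\in[0,T]}$ of nonnegative Radon measures on $(0,\infty)$ (written $f(v,t)\,dv$ even if they have no density) such that 1. $t\mapsto\int_{(0,\infty)}\varphi(v)f(v,t)\,dv$ is continuous on $[0,T]$ for every $\varphi\in C_c((0,\infty))$; 2. $\sup_{t\in[0,T]}\int_{(0,\infty)}(1+v^\gamma)f(v,t)\,dv<\infty$; 3. for every $\varphi\in C_c((0,\infty))$ and every $t\in[0,T]$, $$\int_{(0,\infty)}\varphi(v) f(v,t)\,dv-\int_{(0,\infty)}\varphi(v) f_{\mathrm{in}}(v)\,dv=\frac12\int_0^t\int_{(0,\infty)}\int_{(0,\infty)}K(v,v')\big[\varphi(v+v')-\varphi(v)-\varphi(v')\big]f(v,s)f(v',s)\,dv\,dv'\,ds;$$ 4. $\int_{(0,\infty)}v f(v,t)\,dv=\int_{(0,\infty)}v f_{\mathrm{in}}(v)\,dv$ for all $t\in[0,T]$. Then for no $T\in(0,\infty]$ does there exist a mass-conserving solution on $[0,T]$ with initial datum $f_{\mathrm{in}}$. -/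

import Mathlib

open MeasureTheory Set

namespace Coagulation

/-- The hypotheses on a coagulation kernel `K : [0,∞)² → [0,∞)` of homogeneity-like exponent
`γ > 1`: `K(v,v') = h(v,v') g(v/(v+v'))`, where `h` is comparable to `v^γ + v'^γ` for large
`v + v'` and `g` may vanish only at `1/2`, which it does. Functions on `[0,∞)` and `[0,∞)²` are
represented by functions on `ℝ` and `ℝ × ℝ` about which only the values there matter. -/
def IsAdmissibleKernel (γ : ℝ) (K : ℝ → ℝ → ℝ) : Prop :=
  1 < γ ∧
  (∀ v v' : ℝ, 0 ≤ v → 0 ≤ v' → 0 ≤ K v v') ∧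
  ∃ (h : ℝ → ℝ → ℝ) (g : ℝ → ℝ),
    ContinuousOn (fun p : ℝ × ℝ => h p.1 p.2) (Ici 0 ×ˢ Ici 0) ∧
    ContinuousOn g (Ici 0) ∧
    -- the quotient makes sense for `(v, v') ≠ (0, 0)`
    (∀ v v' : ℝ, 0 ≤ v → 0 ≤ v' → 0 < v + v' → K v v' = h v v' * g (v / (v + v'))) ∧
    (∀ v v' : ℝ, 0 ≤ v → 0 ≤ v' → h v v' = h v' v) ∧
    (∃ H H₀ : ℝ, 1 < H ∧ 0 < H₀ ∧
      ∀ v v' : ℝ, 0 ≤ v → 0 ≤ v' → H < v + v' → H₀ * (v ^ γ + v' ^ γ) ≤ h v v') ∧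
    (∀ R : ℝ, 0 < R → ∃ C : ℝ, 0 < C ∧
      ∀ v ∈ Icc (1 / R) R, ∀ v' ∈ Icc (1 / R) R, C ≤ h v v') ∧
    (∃ H₁ : ℝ, 0 < H₁ ∧ ∀ v v' : ℝ, 0 ≤ v → 0 ≤ v' → h v v' ≤ H₁ * (v ^ γ + v' ^ γ)) ∧
    (∀ x ∈ Icc (0 : ℝ) 1, g x = g (1 - x)) ∧
    g (1 / 2) = 0 ∧
    (∃ G₀ G₁ k : ℝ, 0 < G₀ ∧ 0 < G₁ ∧ 1 ≤ k ∧
      ∀ x ∈ Icc (0 : ℝ) 1, G₀ * |x - 1 / 2| ^ k ≤ g x ∧ g x ≤ G₁)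

/-- Nonnegative Radon measures on `(0,∞)`, represented as Borel measures on `ℝ` that are
concentrated on `(0,∞)` and finite on compact subsets of `(0,∞)` (on this space, regularity is
automatic). No finiteness near `0` is required. -/
structure IsRadonPos (μ : Measure ℝ) : Prop where
  concentrated : μ (Iic 0) = 0
  finite_on_compacts : ∀ A : Set ℝ, IsCompact A → A ⊆ Ioi 0 → μ A < ⊤

/-- The moment `∫ (1 + v^β) dμ(v)`, as an extended nonnegative number. -/
noncomputable def weightedMoment (β : ℝ) (μ : Measure ℝ) : ENNReal :=
  ∫⁻ v, ENNReal.ofReal (1 + v ^ β) ∂μ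

/-- The mass `∫ v dμ(v)`, as an extended nonnegative number. -/
noncomputable def mass (μ : Measure ℝ) : ENNReal :=
  ∫⁻ v, ENNReal.ofReal v ∂μ

/-- The test functions `C_c((0,∞))`, extended by zero to `ℝ`. -/
structure IsTestFunction (φ : ℝ → ℝ) : Prop where
  continuous : Continuous φ
  hasCompactSupport : HasCompactSupport φ
  tsupport_subset : tsupport φ ⊆ Ioi 0

/-- `Θ_φ(v,v') = φ(v+v') - φ(v) - φ(v')`. -/
def Theta (φ : ℝ → ℝ) (v v' : ℝ) : ℝ :=
  φ (v + v') - φ v - φ v'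

/-- The time interval `[0,T]` for `T ∈ (0,∞]`, read as `[0,∞)` when `T = ∞`. -/
def timeInterval (T : EReal) : Set ℝ :=
  {t : ℝ | 0 ≤ t ∧ (t : EReal) ≤ T}

/-- Weak solutions on `[0,T]`, with initial datum `fin`, of the coagulation equation with kernel
`K`: vaguely continuous families of Radon measures with uniformly bounded `(1 + v^γ)`-moment that
satisfy the weak formulation. Values `f t` for `t` outside `[0,T]` are irrelevant. -/
structure IsWeakSolution (γ : ℝ) (K : ℝ → ℝ → ℝ) (fin : Measure ℝ) (T : EReal)
    (f : ℝ → Measure ℝ) : Prop where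
  radon : ∀ t ∈ timeInterval T, IsRadonPos (f t)
  continuous : ∀ φ : ℝ → ℝ, IsTestFunction φ →
    ContinuousOn (fun t => ∫ v, φ v ∂(f t)) (timeInterval T)
  moment_bound : ∃ C : NNReal, ∀ t ∈ timeInterval T, weightedMoment γ (f t) ≤ C
  weak_formulation : ∀ φ : ℝ → ℝ, IsTestFunction φ → ∀ t ∈ timeInterval T,
    (∫ v, φ v ∂(f t)) - (∫ v, φ v ∂fin) =
      (1 / 2) * ∫ s in (0 : ℝ)..t, ∫ v', ∫ v, K v v' * Theta φ v v' ∂(f s) ∂(f s)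

/-- Mass-conserving weak solutions on `[0,T]`. -/
structure IsMassConservingSolution (γ : ℝ) (K : ℝ → ℝ → ℝ) (fin : Measure ℝ) (T : EReal)
    (f : ℝ → Measure ℝ) : Prop extends IsWeakSolution γ K fin T f where
  mass_conserved : ∀ t ∈ timeInterval T, mass (f t) = mass fin

end Coagulation

/-! Suppose a solution exists on `[0, τ]` with `τ` finite, and let `F(A,t) = ∫ (v - A)₊` be the tail
of its size distribution. The function `(v - A)₊` is superadditive for `A ≥ 0`, so under mass
conservation collisions can only increase `F`. Two incompatible facts about `F` follow.

The tail vanishes (`IsBalanced.exists_tail_eq_zero`). The moment bound keeps at least half of the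
mass, `m`, below a fixed size `v₀` at all times. A collision of such a small particle, of size `v`,
with one larger than `A` adds `v` to the tail, and its rate is at least `b A^γ` because sizes so
unequal stay away from the zero of `g`. Formally `∂ₜF ≥ (bm/2) A^γ f((A,∞)) = -(bm/2) A^γ ∂_A F`, so
`F` does not decrease along `A' = (bm/2) A^γ`. As `γ > 1`, these curves reach infinity within a time
of order `A^(1-γ)`, while `F ≤ C A^(1-γ)` tends to zero there. Hence `F(A, τ/2) = 0` for large `A`.

The tail is positive (`IsBalanced.tail_pos`). A Dirac mass is stationary since `K(V,V) = 0`, but a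
datum with two sizes in its support produces arbitrarily large particles instantly, because `K > 0`
off the diagonal.

The tail need not be differentiable, so the argument runs on an integrated balance law between
measures (`exists_isBalanced`) and on finite differences (`le_of_quadratic_error`). -/

namespace Coagulation

open Filter Topology ProbabilityTheory
open scoped ENNReal

/-! ### Measures on the half-line are determined by test functions -/

/-- Tent-like functions increasing with `n` to the indicator of `(a, b)`. -/
noncomputable def tent (a b : ℝ) (n : ℕ) (x : ℝ) : ℝ :=
  min 1 (n * max 0 (min (x - a) (b - x)))

lemma tent_nonneg (a b : ℝ) (n : ℕ) (x : ℝ) : 0 ≤ tent a b n x := by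
  unfold tent; positivity

lemma tent_le_one (a b : ℝ) (n : ℕ) (x : ℝ) : tent a b n x ≤ 1 := min_le_left _ _

lemma tent_eq_zero {a b : ℝ} (n : ℕ) {x : ℝ} (hx : x ∉ Ioo a b) : tent a b n x = 0 := by
  have h : min (x - a) (b - x) ≤ 0 := by
    by_contra! h
    have := lt_min_iff.1 h
    exact hx ⟨by linarith, by linarith⟩
  simp [tent, max_eq_left h]

lemma continuous_tent (a b : ℝ) (n : ℕ) : Continuous (tent a b n) := by
  unfold tent; fun_prop

lemma tendsto_tent (a b x : ℝ) :
    Tendsto (fun n => tent a b n x) atTop (𝓝 ((Ioo a b).indicator 1 x)) := by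
  by_cases hx : x ∈ Ioo a b
  · rw [indicator_of_mem hx]
    have hpos : 0 < max 0 (min (x - a) (b - x)) :=
      lt_max_of_lt_right (lt_min (by linarith [hx.1]) (by linarith [hx.2]))
    have h := tendsto_natCast_atTop_atTop (R := ℝ) |>.atTop_mul_const hpos
    refine tendsto_const_nhds.congr' ?_
    filter_upwards [h.eventually_ge_atTop 1] with n hn
    simp [tent, min_eq_left hn]
  · rw [indicator_of_notMem hx]
    exact tendsto_const_nhds.congr fun n => (tent_eq_zero n hx).symm

lemma isTestFunction_tent {a b : ℝ} (ha : 0 < a) (n : ℕ) : IsTestFunction (tent a b n) := by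
  have hsub : Function.support (tent a b n) ⊆ Icc a b := by
    intro x hx
    by_contra h
    exact hx (tent_eq_zero n fun h' => h (Ioo_subset_Icc_self h'))
  have hts : tsupport (tent a b n) ⊆ Icc a b := closure_minimal hsub isClosed_Icc
  exact ⟨continuous_tent a b n, HasCompactSupport.intro isCompact_Icc fun x hx =>
    Function.notMem_support.1 fun h => hx (hsub h), hts.trans fun _ hx => ha.trans_le hx.1⟩

lemma IsRadonPos.measure_Ioo_lt_top {μ : Measure ℝ} (hμ : IsRadonPos μ) {a b : ℝ}
    (ha : 0 < a) : μ (Ioo a b) < ⊤ :=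
  (measure_mono Ioo_subset_Icc_self).trans_lt
    (hμ.finite_on_compacts _ isCompact_Icc fun _ hx => ha.trans_le hx.1)

lemma IsRadonPos.tendsto_integral_tent {μ : Measure ℝ} (hμ : IsRadonPos μ) {a b : ℝ}
    (ha : 0 < a) : Tendsto (fun n => ∫ x, tent a b n x ∂μ) atTop (𝓝 (μ.real (Ioo a b))) := by
  have hfin : μ (Ioo a b) < ⊤ := hμ.measure_Ioo_lt_top ha
  rw [← integral_indicator_one measurableSet_Ioo]
  refine tendsto_integral_of_dominated_convergence ((Ioo a b).indicator 1)
    (fun n => (continuous_tent a b n).aestronglyMeasurable) ?_ (fun n => ae_of_all _ fun x => ?_)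
    (ae_of_all _ fun x => tendsto_tent a b x)
  · exact (integrable_indicator_iff measurableSet_Ioo).2 (integrableOn_const hfin.ne)
  · rw [Real.norm_of_nonneg (tent_nonneg _ _ _ _)]
    by_cases hx : x ∈ Ioo a b
    · simpa [hx] using tent_le_one a b n x
    · simp [tent_eq_zero n hx, hx]

/-- Either measure may be infinite near `0`, so uniqueness is applied on each `(ε, ∞)`, where the
restriction is locally finite on all of `ℝ`, and then `ε → 0`. -/
lemma IsRadonPos.ext_of_Ioo {μ ν : Measure ℝ} (hμ : IsRadonPos μ) (hν : IsRadonPos ν)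
    (h : ∀ a b : ℝ, 0 < a → μ (Ioo a b) = ν (Ioo a b)) : μ = ν := by
  have hε : ∀ ε : ℝ, 0 < ε → μ.restrict (Ioi ε) = ν.restrict (Ioi ε) := by
    intro ε hε
    have key : ∀ a b : ℝ, Ioo a b ∩ Ioi ε = Ioo (max a ε) b := by
      intro a b; ext x; simp only [mem_inter_iff, mem_Ioo, mem_Ioi, max_lt_iff]; tauto
    have : IsLocallyFiniteMeasure (μ.restrict (Ioi ε)) := by
      refine ⟨fun x => ⟨Ioo (x - 1) (x + 1), Ioo_mem_nhds (by linarith) (by linarith), ?_⟩⟩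
      rw [Measure.restrict_apply measurableSet_Ioo, key]
      exact hμ.measure_Ioo_lt_top (lt_max_of_lt_right hε)
    refine Real.measure_ext_Ioo_rat fun a b => ?_
    rw [Measure.restrict_apply measurableSet_Ioo, Measure.restrict_apply measurableSet_Ioo, key]
    exact h _ _ (lt_max_of_lt_right hε)
  have hU : (⋃ n : ℕ, Ioi (1 / ((n : ℝ) + 1))) = Ioi 0 := by
    ext x
    simp only [mem_iUnion, mem_Ioi]
    exact ⟨fun ⟨n, hn⟩ => lt_trans (by positivity) hn, fun hx => exists_nat_one_div_lt hx⟩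
  have h0 : μ.restrict (Ioi 0) = ν.restrict (Ioi 0) := by
    rw [← hU, Measure.restrict_iUnion_congr]
    exact fun n => hε _ (by positivity)
  have aux : ∀ ρ : Measure ℝ, IsRadonPos ρ → ρ.restrict (Ioi 0) = ρ := fun ρ hρ => by
    refine Measure.restrict_eq_self_of_ae_mem ?_
    rw [ae_iff]
    simpa [Iic_def] using hρ.concentrated
  rw [← aux μ hμ, h0, aux ν hν]

lemma IsRadonPos.ext_of_integral_eq {μ ν : Measure ℝ} (hμ : IsRadonPos μ) (hν : IsRadonPos ν)
    (h : ∀ φ, IsTestFunction φ → ∫ x, φ x ∂μ = ∫ x, φ x ∂ν) : μ = ν := by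
  refine hμ.ext_of_Ioo hν fun a b ha => ?_
  have h1 := hμ.tendsto_integral_tent (b := b) ha
  simp_rw [fun n => h _ (isTestFunction_tent (b := b) ha n)] at h1
  have := tendsto_nhds_unique h1 (hν.tendsto_integral_tent ha)
  exact (measureReal_eq_measureReal_iff (hμ.measure_Ioo_lt_top ha).ne
    (hν.measure_Ioo_lt_top ha).ne).1 this

lemma IsRadonPos.ae_pos {μ : Measure ℝ} (hμ : IsRadonPos μ) : ∀ᵐ v ∂μ, 0 < v := by
  rw [ae_iff]
  simpa [Iic_def] using hμ.concentrated

lemma isRadonPos_of_isFiniteMeasure {μ : Measure ℝ} [IsFiniteMeasure μ] (h : ∀ᵐ v ∂μ, 0 < v) :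
    IsRadonPos μ :=
  ⟨by rw [ae_iff] at h; simpa [Iic_def] using h, fun _ _ _ => measure_lt_top _ _⟩

/-! ### Moments -/

lemma measure_univ_le_weightedMoment {μ : Measure ℝ} (hμ : IsRadonPos μ) (β : ℝ) :
    μ univ ≤ weightedMoment β μ := by
  rw [← lintegral_one, weightedMoment]
  refine lintegral_mono_ae ?_
  filter_upwards [hμ.ae_pos] with v hv
  rw [← ENNReal.ofReal_one]
  exact ENNReal.ofReal_le_ofReal (by linarith [Real.rpow_nonneg hv.le β])

lemma lintegral_rpow_le_weightedMoment (μ : Measure ℝ) (β : ℝ) :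
    ∫⁻ v, ENNReal.ofReal (v ^ β) ∂μ ≤ weightedMoment β μ :=
  lintegral_mono fun _ => ENNReal.ofReal_le_ofReal (by linarith)

/-! ### The solution as a kernel -/

/-- The family `f`, set to zero outside `[0, τ]`. -/
noncomputable def truncatedFamily (τ : ℝ) (f : ℝ → Measure ℝ) (t : ℝ) : Measure ℝ :=
  open Classical in if t ∈ Icc 0 τ then f t else 0

lemma truncatedFamily_of_mem {τ : ℝ} {f : ℝ → Measure ℝ} {t : ℝ} (ht : t ∈ Icc 0 τ) :
    truncatedFamily τ f t = f t := if_pos ht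

/-- Vague continuity makes the integrals of tents measurable in time. Their limits give the
intervals `(a, b)` with `a > 0`, concentration on `(0,∞)` the remaining intervals, and these form a
generating π-system. -/
lemma measurable_truncatedFamily {τ : ℝ} {f : ℝ → Measure ℝ}
    (hrad : ∀ t ∈ Icc 0 τ, IsRadonPos (f t)) (hfin : ∀ t ∈ Icc 0 τ, f t univ < ⊤)
    (hcont : ∀ φ, IsTestFunction φ → ContinuousOn (fun t => ∫ v, φ v ∂(f t)) (Icc 0 τ)) :
    Measurable (truncatedFamily τ f) := by
  have hcase : ∀ t, truncatedFamily τ f t = 0 ∨ t ∈ Icc 0 τ ∧ truncatedFamily τ f t = f t := by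
    intro t
    by_cases ht : t ∈ Icc 0 τ
    · exact Or.inr ⟨ht, if_pos ht⟩
    · exact Or.inl (if_neg ht)
  have hF : ∀ t, IsFiniteMeasure (truncatedFamily τ f t) := by
    intro t
    rcases hcase t with h | ⟨ht, h⟩ <;> rw [h]
    · infer_instance
    · exact ⟨hfin t ht⟩
  have hR : ∀ t, IsRadonPos (truncatedFamily τ f t) := by
    intro t
    rcases hcase t with h | ⟨ht, h⟩ <;> rw [h]
    · exact ⟨rfl, fun _ _ _ => by simp⟩
    · exact hrad t ht
  have hpos : ∀ a b : ℝ, 0 < a → Measurable fun t => truncatedFamily τ f t (Ioo a b) := by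
    intro a b ha
    have hn : ∀ n, Measurable fun t => ∫ x, tent a b n x ∂(truncatedFamily τ f t) := by
      intro n
      classical
      have := (hcont _ (isTestFunction_tent (b := b) ha n)).measurable_piecewise
        (g := fun _ => (0 : ℝ)) continuousOn_const measurableSet_Icc
      convert this using 2 with t
      by_cases ht : t ∈ Icc 0 τ
      · rw [truncatedFamily_of_mem ht, piecewise_eq_of_mem _ _ _ ht]
      · rw [truncatedFamily, if_neg ht, piecewise_eq_of_notMem _ _ _ ht, integral_zero_measure]
    have hl : Measurable fun t => (truncatedFamily τ f t).real (Ioo a b) :=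
      measurable_of_tendsto_metrizable hn
        (tendsto_pi_nhds.2 fun t => (hR t).tendsto_integral_tent ha)
    convert hl.ennreal_ofReal using 2 with t
    rw [ofReal_measureReal]
  have hall : ∀ a b : ℝ, Measurable fun t => truncatedFamily τ f t (Ioo a b) := by
    intro a b
    have heq : ∀ t, truncatedFamily τ f t (Ioo a b) =
        ⨆ n : ℕ, truncatedFamily τ f t (Ioo (max a (1 / ((n : ℝ) + 1))) b) := by
      intro t
      rw [← Monotone.measure_iUnion]
      · refine measure_congr ?_
        filter_upwards [(hR t).ae_pos] with x hx
        refine propext ?_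
        change x ∈ Ioo a b ↔ x ∈ ⋃ n : ℕ, Ioo (max a (1 / ((n : ℝ) + 1))) b
        simp only [mem_iUnion, mem_Ioo, max_lt_iff]
        constructor
        · rintro ⟨h1, h2⟩
          obtain ⟨n, hn⟩ := exists_nat_one_div_lt hx
          exact ⟨n, ⟨h1, hn⟩, h2⟩
        · rintro ⟨n, ⟨h1, -⟩, h2⟩
          exact ⟨h1, h2⟩
      · intro m n hmn
        refine Ioo_subset_Ioo_left (max_le_max le_rfl ?_)
        exact Nat.one_div_le_one_div hmn
    simp_rw [heq]
    exact Measurable.iSup fun n => hpos _ _ (lt_max_of_lt_right (by positivity))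
  refine Measurable.measure_of_isPiSystem Real.borel_eq_generateFrom_Ioo_rat
    Real.isPiSystem_Ioo_rat ?_ ?_
  · rintro s hs
    simp only [mem_iUnion, mem_singleton_iff] at hs
    obtain ⟨a, b, -, rfl⟩ := hs
    exact hall _ _
  · have heq : ∀ t, truncatedFamily τ f t univ =
        ⨆ n : ℕ, truncatedFamily τ f t (Ioo (-(n : ℝ)) n) := by
      intro t
      rw [← Monotone.measure_iUnion]
      · congr 1
        symm
        rw [eq_univ_iff_forall]
        intro x
        obtain ⟨n, hn⟩ := exists_nat_gt |x|
        exact mem_iUnion.2 ⟨n, abs_lt.1 hn⟩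
      · intro m n hmn
        have : (m : ℝ) ≤ n := by exact_mod_cast hmn
        exact Ioo_subset_Ioo (by linarith) this
    simp_rw [heq]
    exact Measurable.iSup fun n => hall _ _

/-! ### The measure of collisions -/

/-- A coagulation kernel as an extended nonnegative function, set to zero off `(0,∞)²`. -/
noncomputable def rate (K : ℝ → ℝ → ℝ) : ℝ × ℝ → ℝ≥0∞ :=
  (Ioi 0 ×ˢ Ioi 0).indicator fun p => ENNReal.ofReal (K p.1 p.2)

lemma rate_of_pos (K : ℝ → ℝ → ℝ) {v w : ℝ} (hv : 0 < v) (hw : 0 < w) :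
    rate K (v, w) = ENNReal.ofReal (K v w) :=
  indicator_of_mem (show (v, w) ∈ Ioi (0:ℝ) ×ˢ Ioi (0:ℝ) from ⟨hv, hw⟩) _

lemma rate_lt_top (K : ℝ → ℝ → ℝ) (p : ℝ × ℝ) : rate K p < ⊤ := by
  unfold rate
  by_cases hp : p ∈ Ioi (0:ℝ) ×ˢ Ioi (0:ℝ)
  · rw [indicator_of_mem hp]; exact ENNReal.ofReal_lt_top
  · rw [indicator_of_notMem hp]; exact ENNReal.zero_lt_top

lemma measurable_rate {K : ℝ → ℝ → ℝ}
    (hK : ContinuousOn (fun p : ℝ × ℝ => K p.1 p.2) (Ioi 0 ×ˢ Ioi 0)) : Measurable (rate K) := by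
  classical
  have hm : MeasurableSet (Ioi (0:ℝ) ×ˢ Ioi (0:ℝ)) := measurableSet_Ioi.prod measurableSet_Ioi
  have := (ENNReal.continuous_ofReal.comp_continuousOn hK).measurable_piecewise
    (g := 0) continuousOn_const hm
  rwa [piecewise_eq_indicator] at this

/-- The collisions that take place during `(s, t]`, counted by the sizes of the two particles. -/
noncomputable def collisions (k : ℝ × ℝ → ℝ≥0∞) (κ : Kernel ℝ ℝ) (s t : ℝ) : Measure (ℝ × ℝ) :=
  ((volume.restrict (Ioc s t)).bind (κ ×ₖ κ)).withDensity k

lemma ae_collisions_pos {k : ℝ × ℝ → ℝ≥0∞} {κ : Kernel ℝ ℝ} (hk : Measurable k)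
    (h0 : ∀ p, p ∉ Ioi (0:ℝ) ×ˢ Ioi (0:ℝ) → k p = 0)
    (s t : ℝ) : ∀ᵐ p ∂(collisions k κ s t), 0 < p.1 ∧ 0 < p.2 := by
  rw [collisions, ae_withDensity_iff hk]
  refine ae_of_all _ fun p hp => ?_
  by_contra hn
  exact hp (h0 p hn)

section collisions

variable {k : ℝ × ℝ → ℝ≥0∞} {κ : Kernel ℝ ℝ} [IsFiniteKernel κ]

lemma lintegral_collisions (hk : Measurable k) {ψ : ℝ × ℝ → ℝ≥0∞} (hψ : Measurable ψ) (s t : ℝ) :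
    ∫⁻ p, ψ p ∂(collisions k κ s t) =
      ∫⁻ r in Ioc s t, ∫⁻ p, k p * ψ p ∂((κ r).prod (κ r)) := by
  rw [collisions, lintegral_withDensity_eq_lintegral_mul _ hk hψ,
    Measure.lintegral_bind (Kernel.aemeasurable _) (hk.mul hψ).aemeasurable]
  simp [Kernel.prod_apply]

lemma collisions_add (hk : Measurable k) {s t u : ℝ} (hst : s ≤ t) (htu : t ≤ u) :
    collisions k κ s u = collisions k κ s t + collisions k κ t u := by
  ext A hA
  have h := fun s t => lintegral_collisions (κ := κ) hk
    (ψ := A.indicator 1) (measurable_one.indicator hA) s t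
  simp only [lintegral_indicator_one hA] at h
  rw [Measure.add_apply, h, h, h, ← Ioc_union_Ioc_eq_Ioc hst htu,
    lintegral_union measurableSet_Ioc (Ioc_disjoint_Ioc_of_le le_rfl)]

lemma collisions_univ_le (hk : Measurable k) {s t : ℝ} {L : ℝ≥0∞}
    (hL : ∀ r ∈ Ioc s t, ∫⁻ p, k p ∂((κ r).prod (κ r)) ≤ L) :
    collisions k κ s t univ ≤ L * ENNReal.ofReal (t - s) := by
  have h := lintegral_collisions (κ := κ) hk (ψ := 1) measurable_one s t
  simp only [Pi.one_apply, lintegral_one, mul_one] at h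
  rw [h]
  refine (setLIntegral_mono' measurableSet_Ioc hL).trans ?_
  simp

/-- This rewrites the iterated integral of the weak formulation. Integrability is free: `ψ` is
bounded and the collision measure, which carries the weight `k`, is finite. -/
lemma integral_collisions (hk : Measurable k) (hk' : ∀ p, k p < ⊤) {s t : ℝ} (hst : s ≤ t)
    [IsFiniteMeasure (collisions k κ s t)] {ψ : ℝ × ℝ → ℝ} (hψ : Measurable ψ) {B : ℝ}
    (hB : ∀ p, ‖ψ p‖ ≤ B) :
    ∫ p, ψ p ∂(collisions k κ s t) =
      ∫ r in s..t, ∫ v', ∫ v, (k (v, v')).toReal * ψ (v, v') ∂(κ r) ∂(κ r) := by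
  have hi : Integrable ψ (collisions k κ s t) :=
    Integrable.of_bound hψ.aestronglyMeasurable B (ae_of_all _ hB)
  rw [collisions, integrable_withDensity_iff_integrable_smul' hk (ae_of_all _ hk'),
    ← Measure.snd_compProd, Measure.snd] at hi
  have hm : Measurable fun p => (k p).toReal • ψ p := hk.ennreal_toReal.smul hψ
  rw [integrable_map_measure hm.aestronglyMeasurable measurable_snd.aemeasurable] at hi
  rw [collisions, integral_withDensity_eq_integral_toReal_smul hk (ae_of_all _ hk'),
    ← Measure.snd_compProd, Measure.snd, integral_map measurable_snd.aemeasurable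
      hm.aestronglyMeasurable, intervalIntegral.integral_of_le hst]
  have h1 := Measure.integral_compProd hi
  simp only [Function.comp_def] at h1
  rw [h1]
  refine integral_congr_ae ?_
  filter_upwards [((Measure.integrable_compProd_iff hi.aestronglyMeasurable).1 hi).1] with r hr
  simp only [Function.comp_def, Kernel.prod_apply] at hr ⊢
  rw [integral_prod_symm _ hr]
  simp

end collisions

lemma lintegral_rate_le {γ C₁ : ℝ} {K : ℝ → ℝ → ℝ} (hC₁ : 0 ≤ C₁)
    (hbound : ∀ v v', 0 < v → 0 < v' → K v v' ≤ C₁ * (v ^ γ + v' ^ γ))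
    {μ : Measure ℝ} [IsFiniteMeasure μ] (hμ : IsRadonPos μ) {C : ℝ≥0∞} (hC : weightedMoment γ μ ≤ C) :
    ∫⁻ p, rate K p ∂(μ.prod μ) ≤ ENNReal.ofReal C₁ * (C * C + C * C) := by
  have hm : Measurable fun v : ℝ => ENNReal.ofReal (v ^ γ) := by fun_prop
  have hle : ∀ p : ℝ × ℝ, rate K p ≤
      ENNReal.ofReal C₁ * (ENNReal.ofReal (p.1 ^ γ) * 1 + 1 * ENNReal.ofReal (p.2 ^ γ)) := by
    rintro ⟨v, w⟩
    by_cases hp : (v, w) ∈ Ioi (0:ℝ) ×ˢ Ioi (0:ℝ)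
    · have hv : 0 < v := hp.1
      have hw : 0 < w := hp.2
      rw [rate_of_pos K hv hw, mul_one, one_mul, ← ENNReal.ofReal_add (by positivity) (by positivity),
        ← ENNReal.ofReal_mul hC₁]
      exact ENNReal.ofReal_le_ofReal (hbound v w hv hw)
    · rw [rate, indicator_of_notMem hp]; exact bot_le
  refine (lintegral_mono hle).trans ?_
  rw [lintegral_const_mul _ (by fun_prop), lintegral_add_left (by fun_prop),
    lintegral_prod_mul (f := fun v : ℝ => ENNReal.ofReal (v ^ γ)) (g := fun _ => 1)
      hm.aemeasurable aemeasurable_const,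
    lintegral_prod_mul (f := fun _ => 1) (g := fun v : ℝ => ENNReal.ofReal (v ^ γ))
      aemeasurable_const hm.aemeasurable, lintegral_one]
  have h1 := (lintegral_rpow_le_weightedMoment μ γ).trans hC
  have h2 := (measure_univ_le_weightedMoment hμ γ).trans hC
  gcongr

/-! ### The coagulation equation as an identity between measures -/

/-- The balance of particles between the times `s ≤ t` of `[0, τ]`, for the family `κ` with
collision rate `k`: two particles disappear and one appears in each collision. -/
structure IsBalanced (k : ℝ × ℝ → ℝ≥0∞) (κ : Kernel ℝ ℝ) (τ : ℝ) : Prop where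
  measurable_rate : Measurable k
  rate_eq_zero : ∀ p, p ∉ Ioi (0:ℝ) ×ˢ Ioi (0:ℝ) → k p = 0
  ae_pos : ∀ t ∈ Icc 0 τ, ∀ᵐ v ∂(κ t), 0 < v
  balance : ∀ s t, 0 ≤ s → s ≤ t → t ≤ τ →
    κ t + κ t + ((collisions k κ s t).map Prod.fst + (collisions k κ s t).map Prod.snd) =
      κ s + κ s + (collisions k κ s t).map (fun p => p.1 + p.2)
  collisions_le : ∃ L : NNReal, ∀ s t, 0 ≤ s → s ≤ t → t ≤ τ →
    collisions k κ s t univ ≤ L * ENNReal.ofReal (t - s)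

/-- The moment bound makes the total collision rate bounded, so the collision measures are finite
and the three terms of `Theta` can be integrated separately. Doubling removes the factor `1/2`, and
moving losses to the other side keeps every term a nonnegative measure. -/
lemma exists_isBalanced {γ C₁ : ℝ} {K : ℝ → ℝ → ℝ} (hC₁ : 0 ≤ C₁)
    (hKc : ContinuousOn (fun p : ℝ × ℝ => K p.1 p.2) (Ioi 0 ×ˢ Ioi 0))
    (hK0 : ∀ v v', 0 < v → 0 < v' → 0 ≤ K v v')
    (hbound : ∀ v v', 0 < v → 0 < v' → K v v' ≤ C₁ * (v ^ γ + v' ^ γ))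
    {fin : Measure ℝ} {T : EReal} {f : ℝ → Measure ℝ} (hf : IsWeakSolution γ K fin T f)
    {τ : ℝ} (hτ : (τ : EReal) ≤ T) :
    ∃ κ : Kernel ℝ ℝ, IsFiniteKernel κ ∧ (∀ t ∈ Icc 0 τ, κ t = f t) ∧
      IsBalanced (rate K) κ τ := by
  have hsub : Icc 0 τ ⊆ timeInterval T := fun t ht =>
    ⟨ht.1, (EReal.coe_le_coe_iff.2 ht.2).trans hτ⟩
  obtain ⟨C, hC⟩ := hf.moment_bound
  have hrad := fun t ht => hf.radon t (hsub ht)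
  have huniv : ∀ t ∈ Icc 0 τ, f t univ ≤ C := fun t ht =>
    (measure_univ_le_weightedMoment (hrad t ht) γ).trans (hC t (hsub ht))
  let κ : Kernel ℝ ℝ := ⟨truncatedFamily τ f, measurable_truncatedFamily hrad
    (fun t ht => (huniv t ht).trans_lt ENNReal.coe_lt_top)
    (fun φ hφ => (hf.continuous φ hφ).mono hsub)⟩
  have hκ : ∀ t ∈ Icc 0 τ, κ t = f t := fun t ht => truncatedFamily_of_mem ht
  have hfin : IsFiniteKernel κ := by
    refine ⟨⟨C, ENNReal.coe_lt_top, fun t => ?_⟩⟩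
    by_cases ht : t ∈ Icc 0 τ
    · rw [hκ t ht]; exact huniv t ht
    · have : κ t = 0 := if_neg ht
      simp [this]
  have hk := measurable_rate hKc
  have hk0 : ∀ p, p ∉ Ioi (0:ℝ) ×ˢ Ioi (0:ℝ) → rate K p = 0 := fun p hp =>
    indicator_of_notMem hp _
  have hpos : ∀ t ∈ Icc 0 τ, ∀ᵐ v ∂(κ t), 0 < v := fun t ht => by
    rw [hκ t ht]; exact (hrad t ht).ae_pos
  have hcol : ∀ s t, 0 ≤ s → s ≤ t → t ≤ τ → collisions (rate K) κ s t univ ≤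
      (C₁.toNNReal * (C * C + C * C) : NNReal) * ENNReal.ofReal (t - s) := by
    intro s t hs _ ht
    refine collisions_univ_le hk fun r hr => ?_
    have hr' : r ∈ Icc 0 τ := ⟨hs.trans hr.1.le, hr.2.trans ht⟩
    have := lintegral_rate_le hC₁ hbound (μ := κ r) (by rw [hκ r hr']; exact hrad r hr')
      (C := C) (by rw [hκ r hr']; exact hC r (hsub hr'))
    exact_mod_cast this
  have hcolfin : ∀ s t, 0 ≤ s → s ≤ t → t ≤ τ → IsFiniteMeasure (collisions (rate K) κ s t) :=
    fun s t hs hst ht => ⟨(hcol s t hs hst ht).trans_lt (by finiteness)⟩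
  refine ⟨κ, hfin, hκ, hk, hk0, hpos, ?_, _, hcol⟩
  intro s t hs hst ht
  have hweak : ∀ φ, IsTestFunction φ → ∀ t, 0 ≤ t → t ≤ τ →
      (∫ v, φ v ∂(κ t)) - (∫ v, φ v ∂fin) =
        (1 / 2) * ∫ p, Theta φ p.1 p.2 ∂(collisions (rate K) κ 0 t) := by
    intro φ hφ t h0 ht
    have := hcolfin 0 t le_rfl h0 ht
    obtain ⟨B, hB⟩ := hφ.hasCompactSupport.exists_bound_of_continuous hφ.continuous
    have hφm := hφ.continuous.measurable
    have hΘ : Measurable fun p : ℝ × ℝ => Theta φ p.1 p.2 := by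
      unfold Theta
      exact ((hφm.comp (measurable_fst.add measurable_snd)).sub (hφm.comp measurable_fst)).sub
        (hφm.comp measurable_snd)
    have hΘB : ∀ p : ℝ × ℝ, ‖Theta φ p.1 p.2‖ ≤ B + B + B := fun p =>
      (norm_sub_le _ _).trans (add_le_add ((norm_sub_le _ _).trans (add_le_add (hB _) (hB _))) (hB _))
    rw [integral_collisions hk (rate_lt_top K) h0 hΘ hΘB, hκ t ⟨h0, ht⟩,
      hf.weak_formulation φ hφ t (hsub ⟨h0, ht⟩)]
    congr 1
    refine intervalIntegral.integral_congr fun r hr => ?_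
    rw [uIcc_of_le h0] at hr
    have hr' : r ∈ Icc 0 τ := ⟨hr.1, hr.2.trans ht⟩
    simp only [hκ r hr']
    refine integral_congr_ae ?_
    filter_upwards [(hrad r hr').ae_pos] with v' hv'
    refine integral_congr_ae ?_
    filter_upwards [(hrad r hr').ae_pos] with v hv
    rw [rate_of_pos K hv hv', ENNReal.toReal_ofReal (hK0 v v' hv hv')]
  have := hcolfin s t hs hst ht
  have := hcolfin 0 s le_rfl hs (hst.trans ht)
  set ν := collisions (rate K) κ s t with hν
  have hνpos : ∀ᵐ p ∂ν, 0 < p.1 ∧ 0 < p.2 := ae_collisions_pos hk hk0 s t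
  have hmap : ∀ g : ℝ × ℝ → ℝ, Measurable g → (∀ p : ℝ × ℝ, 0 < p.1 → 0 < p.2 → 0 < g p) →
      ∀ᵐ v ∂(ν.map g), 0 < v := by
    intro g hg h
    rw [ae_map_iff hg.aemeasurable measurableSet_Ioi]
    filter_upwards [hνpos] with p hp using h p hp.1 hp.2
  have hadd : Measurable fun p : ℝ × ℝ => p.1 + p.2 := by fun_prop
  have hs' : s ∈ Icc 0 τ := ⟨hs, hst.trans ht⟩
  have ht' : t ∈ Icc 0 τ := ⟨hs.trans hst, ht⟩
  refine (isRadonPos_of_isFiniteMeasure ?_).ext_of_integral_eq (isRadonPos_of_isFiniteMeasure ?_) ?_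
  · simp only [ae_add_measure_iff]
    exact ⟨⟨hpos t ht', hpos t ht'⟩, hmap _ measurable_fst fun p h _ => h,
      hmap _ measurable_snd fun p _ h => h⟩
  · simp only [ae_add_measure_iff]
    exact ⟨⟨hpos s hs', hpos s hs'⟩, hmap _ hadd fun p h h' => add_pos h h'⟩
  -- Subtracting the weak formulation at `s` from that at `t` eliminates `fin` and leaves the
  -- collisions of `(s, t]`.
  · intro φ hφ
    obtain ⟨B, hB⟩ := hφ.hasCompactSupport.exists_bound_of_continuous hφ.continuous
    have hφm := hφ.continuous.measurable
    have hi : ∀ (μ : Measure ℝ) [IsFiniteMeasure μ], Integrable φ μ := fun μ _ =>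
      Integrable.of_bound hφm.aestronglyMeasurable B (ae_of_all _ hB)
    have hj : ∀ (μ : Measure (ℝ × ℝ)) [IsFiniteMeasure μ] (g : ℝ × ℝ → ℝ), Measurable g →
        Integrable (fun p => φ (g p)) μ := fun μ _ g hg =>
      Integrable.of_bound (hφm.comp hg).aestronglyMeasurable B (ae_of_all _ fun p => hB _)
    have hΘ : ∀ (μ : Measure (ℝ × ℝ)) [IsFiniteMeasure μ],
        Integrable (fun p => Theta φ p.1 p.2) μ := fun μ _ =>
      ((hj μ _ hadd).sub (hj μ _ measurable_fst)).sub (hj μ _ measurable_snd)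
    have e1 := hweak φ hφ t (hs.trans hst) ht
    have e2 := hweak φ hφ s hs (hst.trans ht)
    rw [collisions_add hk hs hst, integral_add_measure (hΘ _) (hΘ _), ← hν] at e1
    have e3 : ∫ p, Theta φ p.1 p.2 ∂ν = ∫ p, φ (p.1 + p.2) ∂ν - ∫ p, φ p.1 ∂ν - ∫ p, φ p.2 ∂ν := by
      unfold Theta
      have hsub : Integrable (fun p : ℝ × ℝ => φ (p.1 + p.2) - φ p.1) ν :=
        (hj ν _ hadd).sub (hj ν _ measurable_fst)
      rw [integral_sub hsub (hj ν _ measurable_snd),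
        integral_sub (hj ν _ hadd) (hj ν _ measurable_fst)]
    rw [integral_add_measure (hi _) (hi _), integral_add_measure (hi _) (hi _),
      integral_add_measure (hi _) (hi _), integral_add_measure (hi _) (hi _),
      integral_add_measure (hi _) (hi _),
      integral_map measurable_fst.aemeasurable hφm.aestronglyMeasurable,
      integral_map measurable_snd.aemeasurable hφm.aestronglyMeasurable,
      integral_map hadd.aemeasurable hφm.aestronglyMeasurable]
    linarith

/-! ### The tail of the mass distribution -/

/-- The truncated moment `∫ (v - A)₊ dμ(v)`. -/
noncomputable def tail (μ : Measure ℝ) (A : ℝ) : ℝ≥0∞ :=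
  ∫⁻ v, ENNReal.ofReal (v - A) ∂μ

/-- The change of `(· - A)₊`, summed over the particles, in a collision. -/
noncomputable def excess (A : ℝ) (p : ℝ × ℝ) : ℝ :=
  min p.1 A + min p.2 A - min (p.1 + p.2) A

lemma measurable_ofReal_excess (A : ℝ) : Measurable fun p => ENNReal.ofReal (excess A p) := by
  unfold excess; fun_prop

lemma excess_nonneg {A v w : ℝ} (hA : 0 ≤ A) (hv : 0 ≤ v) (hw : 0 ≤ w) : 0 ≤ excess A (v, w) := by
  simp only [excess]
  rcases le_total v A with h1 | h1 <;> rcases le_total w A with h2 | h2 <;>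
    rcases le_total (v + w) A with h3 | h3 <;> simp [h1, h2, h3] <;> linarith

lemma excess_eq {A v w : ℝ} (hv : 0 ≤ v) (hvA : v ≤ A) (hw : A ≤ w) : excess A (v, w) = v := by
  simp only [excess]
  rw [min_eq_left hvA, min_eq_right hw, min_eq_right (by linarith)]
  ring

/-- The merged particle exceeds `A + α`, and the truncated sizes of the two parents still sum to
more than `A + α`. This is what raises the level by `α` in `IsBalanced.tail_pos`. -/
lemma excess_pos {A α v w : ℝ} (hα : 0 < α) (hA : 0 < A) (hv : α ≤ v) (hw : A < w) :
    0 < excess (A + α) (v, w) := by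
  simp only [excess]
  rw [min_eq_right (a := v + w) (by linarith)]
  rcases le_total v (A + α) with h1 | h1 <;> rcases le_total w (A + α) with h2 | h2 <;>
    simp [h1, h2] <;> linarith

lemma lintegral_min_add_tail {μ : Measure ℝ} (hμ : ∀ᵐ v ∂μ, 0 < v) {A : ℝ} (hA : 0 ≤ A) :
    ∫⁻ v, ENNReal.ofReal (min v A) ∂μ + tail μ A = mass μ := by
  rw [tail, mass, ← lintegral_add_left (by fun_prop)]
  refine lintegral_congr_ae ?_
  filter_upwards [hμ] with v hv
  rcases le_total v A with h | h
  · rw [min_eq_left h, ENNReal.ofReal_of_nonpos (p := v - A) (by linarith), add_zero]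
  · rw [min_eq_right h, ← ENNReal.ofReal_add hA (by linarith)]
    congr 1; ring

lemma tail_le_mass (μ : Measure ℝ) {A : ℝ} (hA : 0 ≤ A) : tail μ A ≤ mass μ :=
  lintegral_mono fun _ => ENNReal.ofReal_le_ofReal (by linarith)

lemma le_rpow_mul_rpow {γ A v : ℝ} (hγ : 1 ≤ γ) (hA : 0 < A) (hv : A < v) :
    v ≤ A ^ (1 - γ) * v ^ γ := by
  have hv0 : 0 < v := hA.trans hv
  have h1 : v ^ (1 - γ) ≤ A ^ (1 - γ) :=
    Real.rpow_le_rpow_of_nonpos hA hv.le (by linarith)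
  calc v = v ^ (1 - γ) * v ^ γ := by rw [← Real.rpow_add hv0]; simp
    _ ≤ _ := by gcongr

lemma setLIntegral_Ioi_le {γ : ℝ} (hγ : 1 ≤ γ) {A : ℝ} (hA : 0 < A) (μ : Measure ℝ) :
    ∫⁻ v in Ioi A, ENNReal.ofReal v ∂μ ≤ ENNReal.ofReal (A ^ (1 - γ)) * weightedMoment γ μ := by
  calc ∫⁻ v in Ioi A, ENNReal.ofReal v ∂μ
      ≤ ∫⁻ v in Ioi A, ENNReal.ofReal (A ^ (1 - γ)) * ENNReal.ofReal (v ^ γ) ∂μ := by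
        refine setLIntegral_mono' measurableSet_Ioi fun v hv => ?_
        rw [← ENNReal.ofReal_mul (by positivity)]
        exact ENNReal.ofReal_le_ofReal (le_rpow_mul_rpow hγ hA hv)
    _ ≤ ∫⁻ v, ENNReal.ofReal (A ^ (1 - γ)) * ENNReal.ofReal (v ^ γ) ∂μ :=
        setLIntegral_le_lintegral _ _
    _ = ENNReal.ofReal (A ^ (1 - γ)) * ∫⁻ v, ENNReal.ofReal (v ^ γ) ∂μ :=
        lintegral_const_mul _ (by fun_prop)
    _ ≤ _ := by gcongr; exact lintegral_rpow_le_weightedMoment μ γ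

lemma tail_le {γ : ℝ} (hγ : 1 ≤ γ) {A : ℝ} (hA : 0 < A) (μ : Measure ℝ) :
    tail μ A ≤ ENNReal.ofReal (A ^ (1 - γ)) * weightedMoment γ μ := by
  refine le_trans ?_ (setLIntegral_Ioi_le hγ hA μ)
  rw [tail, ← lintegral_indicator measurableSet_Ioi]
  refine lintegral_mono fun v => ?_
  by_cases hv : v ∈ Ioi A
  · rw [indicator_of_mem hv]
    exact ENNReal.ofReal_le_ofReal (by linarith)
  · rw [indicator_of_notMem hv, ENNReal.ofReal_of_nonpos]
    have := notMem_Ioi.1 hv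
    linarith

lemma tail_le_tail_add (μ : Measure ℝ) (A δ : ℝ) :
    tail μ A ≤ tail μ (A + δ) + ENNReal.ofReal δ * μ (Ioi A) := by
  rw [tail, tail, ← lintegral_indicator_const measurableSet_Ioi, ← lintegral_add_left (by fun_prop)]
  refine lintegral_mono fun v => ?_
  by_cases hv : v ∈ Ioi A
  · simp only [indicator_of_mem hv]
    refine (ENNReal.ofReal_le_ofReal ?_).trans ENNReal.ofReal_add_le
    linarith
  · have := notMem_Ioi.1 hv
    rw [ENNReal.ofReal_of_nonpos (by linarith)]
    exact bot_le

lemma tail_pos_iff {μ : Measure ℝ} {A : ℝ} : 0 < tail μ A ↔ 0 < μ (Ioi A) := by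
  rw [tail, lintegral_pos_iff_support (by fun_prop)]
  have : (Function.support fun v : ℝ => ENNReal.ofReal (v - A)) = Ioi A := by
    ext v; simp
  rw [this]

/-! ### Consequences of the balance identity -/

namespace IsBalanced

variable {k : ℝ × ℝ → ℝ≥0∞} {κ : Kernel ℝ ℝ} {τ : ℝ}

lemma isFiniteMeasure_collisions (hb : IsBalanced k κ τ) {s t : ℝ} (hs : 0 ≤ s) (hst : s ≤ t)
    (ht : t ≤ τ) : IsFiniteMeasure (collisions k κ s t) := by
  obtain ⟨L, hL⟩ := hb.collisions_le
  exact ⟨(hL s t hs hst ht).trans_lt (by finiteness)⟩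

lemma lintegral_balance (hb : IsBalanced k κ τ) {s t : ℝ} (hs : 0 ≤ s) (hst : s ≤ t) (ht : t ≤ τ)
    {φ : ℝ → ℝ≥0∞} (hφ : Measurable φ) :
    ∫⁻ v, φ v ∂κ t + ∫⁻ v, φ v ∂κ t +
        (∫⁻ p, φ p.1 ∂(collisions k κ s t) + ∫⁻ p, φ p.2 ∂(collisions k κ s t)) =
      ∫⁻ v, φ v ∂κ s + ∫⁻ v, φ v ∂κ s + ∫⁻ p, φ (p.1 + p.2) ∂(collisions k κ s t) := by
  have h := congrArg (fun μ => ∫⁻ v, φ v ∂μ) (hb.balance s t hs hst ht)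
  have hadd : Measurable fun p : ℝ × ℝ => p.1 + p.2 := by fun_prop
  simpa only [lintegral_add_measure, lintegral_map hφ measurable_fst,
    lintegral_map hφ measurable_snd, lintegral_map hφ hadd] using h

/-- The balance is tested with the bounded function `min v A`, whose integrals are finite. Since
`min v A + (v - A)₊ = v`, mass conservation turns the loss of `∫ min v A` into a gain of the tail.
-/
lemma tail_balance (hb : IsBalanced k κ τ) {M : ℝ≥0∞} (hM : M ≠ ⊤)
    (hmass : ∀ t ∈ Icc 0 τ, mass (κ t) = M) {s t : ℝ} (hs : 0 ≤ s) (hst : s ≤ t) (ht : t ≤ τ)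
    {A : ℝ} (hA : 0 ≤ A) :
    tail (κ t) A + tail (κ t) A = tail (κ s) A + tail (κ s) A +
      ∫⁻ p, ENNReal.ofReal (excess A p) ∂(collisions k κ s t) := by
  have hfin := hb.isFiniteMeasure_collisions hs hst ht
  have hs' : s ∈ Icc 0 τ := ⟨hs, hst.trans ht⟩
  have ht' : t ∈ Icc 0 τ := ⟨hs.trans hst, ht⟩
  have h := hb.lintegral_balance hs hst ht (φ := fun v => ENNReal.ofReal (min v A)) (by fun_prop)
  have hE : ∫⁻ p, ENNReal.ofReal (min p.1 A) ∂(collisions k κ s t) +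
      ∫⁻ p, ENNReal.ofReal (min p.2 A) ∂(collisions k κ s t) =
      ∫⁻ p, ENNReal.ofReal (excess A p) ∂(collisions k κ s t) +
      ∫⁻ p, ENNReal.ofReal (min (p.1 + p.2) A) ∂(collisions k κ s t) := by
    rw [← lintegral_add_left (by fun_prop), ← lintegral_add_left (measurable_ofReal_excess A)]
    refine lintegral_congr_ae ?_
    filter_upwards [ae_collisions_pos hb.measurable_rate hb.rate_eq_zero s t] with p hp
    have h1 : 0 ≤ min p.1 A := le_min hp.1.le hA
    have h2 : 0 ≤ min p.2 A := le_min hp.2.le hA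
    have h3 : 0 ≤ min (p.1 + p.2) A := le_min (add_pos hp.1 hp.2).le hA
    rw [← ENNReal.ofReal_add h1 h2,
      ← ENNReal.ofReal_add (excess_nonneg hA hp.1.le hp.2.le) h3, excess]
    congr 1; ring
  have hne : ∫⁻ p, ENNReal.ofReal (min (p.1 + p.2) A) ∂(collisions k κ s t) ≠ ⊤ := by
    refine ((lintegral_mono fun p => ENNReal.ofReal_le_ofReal (min_le_right _ _)).trans_lt ?_).ne
    rw [lintegral_const]
    finiteness
  rw [hE, ← add_assoc] at h
  have h' := (ENNReal.add_left_inj hne).1 h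
  have e1 := (lintegral_min_add_tail (hb.ae_pos s hs') hA).trans (hmass s hs')
  have e2 := (lintegral_min_add_tail (hb.ae_pos t ht') hA).trans (hmass t ht')
  have hms : ∫⁻ v, ENNReal.ofReal (min v A) ∂(κ s) ≠ ⊤ :=
    ne_top_of_le_ne_top hM (e1 ▸ le_self_add)
  have hmss := ENNReal.add_ne_top.2 ⟨hms, hms⟩
  generalize ∫⁻ v, ENNReal.ofReal (min v A) ∂(κ s) = ms at *
  generalize ∫⁻ v, ENNReal.ofReal (min v A) ∂(κ t) = mt at *
  generalize ∫⁻ p, ENNReal.ofReal (excess A p) ∂(collisions k κ s t) = E at *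
  rw [← ENNReal.add_left_inj hmss]
  calc tail (κ t) A + tail (κ t) A + (ms + ms)
      = (mt + tail (κ t) A) + (mt + tail (κ t) A) + E := by rw [← h']; ring
    _ = (ms + tail (κ s) A) + (ms + tail (κ s) A) + E := by rw [e1, e2]
    _ = _ := by ring

/-- Lipschitz continuity in time, uniformly over Borel sets: only collisions can change the measure
of a set. -/
lemma measure_balance_le (hb : IsBalanced k κ τ) {L : NNReal}
    (hL : ∀ s t, 0 ≤ s → s ≤ t → t ≤ τ → collisions k κ s t univ ≤ L * ENNReal.ofReal (t - s))
    {s t : ℝ} (hs : 0 ≤ s) (hst : s ≤ t) (ht : t ≤ τ) {B : Set ℝ} (hB : MeasurableSet B) :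
    κ t B ≤ κ s B + L * ENNReal.ofReal (t - s) ∧ κ s B ≤ κ t B + L * ENNReal.ofReal (t - s) := by
  have h := congrArg (fun μ => μ B) (hb.balance s t hs hst ht)
  have hadd : Measurable fun p : ℝ × ℝ => p.1 + p.2 := by fun_prop
  simp only [Measure.add_apply, Measure.map_apply measurable_fst hB,
    Measure.map_apply measurable_snd hB, Measure.map_apply hadd hB] at h
  have hle : ∀ E, collisions k κ s t E ≤ L * ENNReal.ofReal (t - s) := fun E =>
    (measure_mono (subset_univ E)).trans (hL s t hs hst ht)
  have two : ∀ a b c : ℝ≥0∞, a + a ≤ b + b + (c + c) → a ≤ b + c := by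
    intro a b c h
    by_contra! hn
    exact absurd h (not_le.2 (by
      calc b + b + (c + c) = (b + c) + (b + c) := by ring
        _ < a + a := ENNReal.add_lt_add hn hn))
  constructor
  · refine two _ _ _ ?_
    calc _ ≤ _ := le_self_add
      _ = _ := h
      _ ≤ _ := by gcongr; exact (hle _).trans le_self_add
  · refine two _ _ _ ?_
    calc _ ≤ _ := le_self_add
      _ = _ := h.symm
      _ ≤ _ := by gcongr <;> exact hle _

end IsBalanced

/-! ### Transport of the tail to infinity -/

/-- Cutting `h` into `n + 1` equal steps leaves a total error `C h² / (n + 1)`, which tends to zero.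
-/
lemma le_of_quadratic_error {D : ℝ → ℝ → ℝ} {A σ C τ : ℝ} (hσ : 0 ≤ σ)
    (hD : ∀ a t h, A ≤ a → 0 ≤ t → 0 ≤ h → t + h ≤ τ → D a t - C * h ^ 2 ≤ D (a + σ * h) (t + h))
    {a t h : ℝ} (ha : A ≤ a) (ht : 0 ≤ t) (hh : 0 ≤ h) (hth : t + h ≤ τ) :
    D a t ≤ D (a + σ * h) (t + h) := by
  have key : ∀ n : ℕ, D a t - C * h ^ 2 * (1 / ((n : ℝ) + 1)) ≤ D (a + σ * h) (t + h) := by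
    intro n
    set e : ℝ := h / (n + 1) with he
    have he0 : 0 ≤ e := by positivity
    have hen : ((n : ℝ) + 1) * e = h := by rw [he]; field_simp
    have hj : ∀ j : ℕ, j ≤ n + 1 → D a t - j * (C * e ^ 2) ≤ D (a + σ * (j * e)) (t + j * e) := by
      intro j
      induction j with
      | zero => intro _; simp
      | succ j ih =>
        intro hjn
        have h1 := ih (by omega)
        have hjn' : ((j : ℝ) + 1) ≤ n + 1 := by exact_mod_cast hjn
        have h3 : ((j : ℝ) + 1) * e ≤ h := by rw [← hen]; gcongr
        have h2 := hD (a + σ * (j * e)) (t + j * e) e (by nlinarith [mul_nonneg hσ (by positivity : 0 ≤ j * e)])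
          (by positivity) he0 (by linarith)
        push_cast
        have e1 : a + σ * (((j : ℝ) + 1) * e) = a + σ * (j * e) + σ * e := by ring
        have e2 : t + ((j : ℝ) + 1) * e = t + j * e + e := by ring
        rw [e1, e2]
        linarith
    have := hj (n + 1) le_rfl
    push_cast at this
    rw [hen] at this
    convert this using 2
    rw [he]; field_simp
  have hlim : Tendsto (fun n : ℕ => D a t - C * h ^ 2 * (1 / ((n : ℝ) + 1))) atTop
      (𝓝 (D a t - C * h ^ 2 * 0)) :=
    tendsto_const_nhds.sub (tendsto_one_div_add_atTop_nhds_zero_nat.const_mul _)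
  rw [mul_zero, sub_zero] at hlim
  exact le_of_tendsto' hlim key

/-- A quantity that is transported along `a' = b a ^ γ` and vanishes at infinity vanishes where
the characteristics blow up in time. -/
lemma exists_nonpos_of_transport {D : ℝ → ℝ → ℝ} {γ b A₀ C₀ L τ : ℝ} (hγ : 1 < γ) (hb : 0 < b)
    (hτ : 0 < τ)
    (hD : ∀ A a t h, A₀ ≤ A → 0 < A → A ≤ a → 0 ≤ t → 0 ≤ h → t + h ≤ τ →
      D a t - b * A ^ γ * L * h ^ 2 ≤ D (a + b * A ^ γ * h) (t + h))
    (hdecay : ∀ a t, 0 < a → t ∈ Icc 0 τ → D a t ≤ C₀ * a ^ (1 - γ)) :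
    ∃ A₁ : ℝ, ∀ A, A₁ ≤ A → D A (τ / 2) ≤ 0 := by
  set q : ℝ := 2 ^ (1 - γ) with hq
  have hq0 : 0 < q := by positivity
  have hq1 : q < 1 := Real.rpow_lt_one_of_one_lt_of_neg (by norm_num) (by linarith)
  -- Above level `A` the speed is at least `b A^γ`; frozen at this value, it carries `A` to `2A` in
  -- time `A^(1-γ) / b`.
  have hdouble : ∀ A t, A₀ ≤ A → 0 < A → 0 ≤ t → t + A ^ (1 - γ) / b ≤ τ →
      D A t ≤ D (2 * A) (t + A ^ (1 - γ) / b) := by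
    intro A t hA₀ hA ht hle
    have h1 := le_of_quadratic_error (D := D) (A := A) (σ := b * A ^ γ) (C := b * A ^ γ * L)
      (τ := τ) (by positivity) (fun a t h ha h0 h0' hh => hD A a t h hA₀ hA ha h0 h0' hh)
      le_rfl ht (by positivity) hle
    have e : A + b * A ^ γ * (A ^ (1 - γ) / b) = 2 * A := by
      have : A ^ γ * A ^ (1 - γ) = A := by rw [← Real.rpow_add hA]; simp
      calc _ = A + A ^ γ * A ^ (1 - γ) := by field_simp
        _ = _ := by rw [this]; ring
    rwa [e] at h1
  -- Successive doubling times shrink by the factor `q`, so all of them together fit into the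
  -- remaining time `τ / 2`.
  have hsmall : ∀ᶠ A : ℝ in atTop, A ^ (1 - γ) / b * (1 - q)⁻¹ ≤ τ / 2 := by
    have h1 : Tendsto (fun A : ℝ => A ^ (1 - γ)) atTop (𝓝 0) := by
      have := tendsto_rpow_neg_atTop (y := γ - 1) (by linarith)
      simpa using this
    have h2 := (h1.div_const b).mul_const (1 - q)⁻¹
    rw [zero_div, zero_mul] at h2
    exact (h2.eventually_lt_const (by positivity : 0 < τ / 2)).mono fun _ h => h.le
  obtain ⟨A₁, hA₁⟩ := eventually_atTop.1
    (hsmall.and ((eventually_ge_atTop A₀).and (eventually_gt_atTop 0)))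
  refine ⟨A₁, fun A hA => ?_⟩
  obtain ⟨hs, hAA₀, hA0⟩ := hA₁ A hA
  set w : ℝ := A ^ (1 - γ) / b with hw
  have hw0 : 0 ≤ w := by positivity
  have hgeom : ∀ n, ∑ j ∈ Finset.range n, q ^ j ≤ (1 - q)⁻¹ := fun n => by
    rw [← tsum_geometric_of_lt_one hq0.le hq1]
    exact (summable_geometric_of_lt_one hq0.le hq1).sum_le_tsum _ fun _ _ => by positivity
  have hsum : ∀ n, w * ∑ j ∈ Finset.range n, q ^ j ≤ τ / 2 := fun n =>
    (mul_le_mul_of_nonneg_left (hgeom n) hw0).trans hs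
  have hiter : ∀ n : ℕ, D A (τ / 2) ≤
      D (2 ^ n * A) (τ / 2 + w * ∑ j ∈ Finset.range n, q ^ j) := by
    intro n
    induction n with
    | zero => simp
    | succ n ih =>
      refine ih.trans ?_
      have e0 : (2 ^ n * A) ^ (1 - γ) / b = w * q ^ n := by
        rw [Real.mul_rpow (by positivity) hA0.le, hw, hq, ← Real.rpow_natCast, ← Real.rpow_mul
          (by norm_num), ← Real.rpow_natCast, ← Real.rpow_mul (by norm_num), mul_comm (n : ℝ)]
        ring
      have e1 : τ / 2 + w * ∑ j ∈ Finset.range (n + 1), q ^ j =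
          τ / 2 + w * ∑ j ∈ Finset.range n, q ^ j + (2 ^ n * A) ^ (1 - γ) / b := by
        rw [Finset.sum_range_succ, e0]; ring
      have e2 : (2 : ℝ) ^ (n + 1) * A = 2 * (2 ^ n * A) := by ring
      have hge : A ≤ 2 ^ n * A := le_mul_of_one_le_left hA0.le (one_le_pow₀ (by norm_num))
      have := hsum (n + 1)
      rw [e2, e1]
      refine hdouble _ _ (hAA₀.trans hge) (by positivity) (by positivity) ?_
      rw [← e1]; linarith
  have hbound : ∀ n : ℕ, D A (τ / 2) ≤ C₀ * A ^ (1 - γ) * q ^ n := by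
    intro n
    refine (hiter n).trans ?_
    have h0 : 0 ≤ w * ∑ j ∈ Finset.range n, q ^ j := by positivity
    refine (hdecay _ _ (by positivity) ⟨by linarith, by linarith [hsum n]⟩).trans (le_of_eq ?_)
    rw [Real.mul_rpow (by positivity) hA0.le, hq, ← Real.rpow_natCast, ← Real.rpow_mul
      (by norm_num), ← Real.rpow_natCast, ← Real.rpow_mul (by norm_num), mul_comm (n : ℝ)]
    ring
  have hlim := (tendsto_pow_atTop_nhds_zero_of_lt_one hq0.le hq1).const_mul (C₀ * A ^ (1 - γ))
  rw [mul_zero] at hlim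
  exact ge_of_tendsto' hlim hbound

/-! ### Bounds for admissible kernels -/

lemma IsAdmissibleKernel.continuousOn {γ : ℝ} {K : ℝ → ℝ → ℝ} (hK : IsAdmissibleKernel γ K) :
    ContinuousOn (fun p : ℝ × ℝ => K p.1 p.2) (Ioi 0 ×ˢ Ioi 0) := by
  obtain ⟨-, -, h, g, hh, hg, hKhg, -⟩ := hK
  have hsub : (Ioi (0:ℝ) ×ˢ Ioi (0:ℝ)) ⊆ Ici (0:ℝ) ×ˢ Ici (0:ℝ) :=
    prod_mono Ioi_subset_Ici_self Ioi_subset_Ici_self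
  have hquot : ContinuousOn (fun p : ℝ × ℝ => p.1 / (p.1 + p.2)) (Ioi 0 ×ˢ Ioi 0) :=
    continuousOn_fst.div (by fun_prop) fun p hp => (add_pos hp.1 hp.2).ne'
  refine ((hh.mono hsub).mul (hg.comp hquot fun p hp => ?_)).congr fun p hp => ?_
  · have h1 : 0 < p.1 := hp.1
    have h2 : 0 < p.2 := hp.2
    exact (div_pos h1 (add_pos h1 h2)).le
  · exact hKhg p.1 p.2 (le_of_lt hp.1) (le_of_lt hp.2) (add_pos hp.1 hp.2)

lemma IsAdmissibleKernel.exists_le {γ : ℝ} {K : ℝ → ℝ → ℝ} (hK : IsAdmissibleKernel γ K) :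
    ∃ C : ℝ, 0 ≤ C ∧ ∀ v v', 0 < v → 0 < v' → K v v' ≤ C * (v ^ γ + v' ^ γ) := by
  obtain ⟨-, -, h, g, -, -, hKhg, -, -, -, ⟨H₁, hH₁, hup⟩, -, -, G₀, G₁, k, hG₀, hG₁, -, hg⟩ := hK
  refine ⟨H₁ * G₁, by positivity, fun v v' hv hv' => ?_⟩
  have hx : v / (v + v') ∈ Icc (0:ℝ) 1 :=
    ⟨by positivity, (div_le_one (by positivity)).2 (by linarith)⟩
  obtain ⟨h1, h2⟩ := hg _ hx
  have h0 : 0 ≤ g (v / (v + v')) := le_trans (by positivity) h1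
  rw [hKhg v v' hv.le hv'.le (by positivity)]
  calc h v v' * g (v / (v + v')) ≤ H₁ * (v ^ γ + v' ^ γ) * G₁ :=
        mul_le_mul (hup v v' hv.le hv'.le) h2 h0 (by positivity)
    _ = _ := by ring

/-- For `4 v ≤ v'` the ratio `v / (v + v')` is at most `1/4`, so `g` is bounded below by `G₀
(1/4)^k` despite its zero at `1/2`. -/
lemma IsAdmissibleKernel.exists_ge {γ : ℝ} {K : ℝ → ℝ → ℝ} (hK : IsAdmissibleKernel γ K) :
    ∃ b H : ℝ, 0 < b ∧ 0 < H ∧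
      ∀ v v', 0 < v → 4 * v ≤ v' → H < v' → b * v' ^ γ ≤ K v v' := by
  obtain ⟨-, -, h, g, -, -, hKhg, -, ⟨H, H₀, hH, hH₀, hlow⟩, -, -, -, -, G₀, G₁, k, hG₀, -, hk, hg⟩ :=
    hK
  refine ⟨H₀ * (G₀ * (1 / 4) ^ k), H, by positivity, by linarith, fun v v' hv hvv' hHv' => ?_⟩
  have hv' : 0 < v' := by linarith
  have hx4 : v / (v + v') ≤ 1 / 4 := by rw [div_le_div_iff₀] <;> linarith
  have hx : v / (v + v') ∈ Icc (0:ℝ) 1 := ⟨by positivity, hx4.trans (by norm_num)⟩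
  have hg' : G₀ * (1 / 4) ^ k ≤ g (v / (v + v')) := by
    refine le_trans ?_ (hg _ hx).1
    gcongr
    rw [abs_of_nonpos] <;> linarith
  rw [hKhg v v' hv.le hv'.le (by positivity)]
  calc _ = H₀ * v' ^ γ * (G₀ * (1 / 4) ^ k) := by ring
    _ ≤ h v v' * g (v / (v + v')) := by
      refine mul_le_mul (le_trans ?_ (hlow v v' hv.le hv'.le (by linarith))) hg'
        (by positivity) (le_trans (by positivity) (hlow v v' hv.le hv'.le (by linarith)))
      gcongr
      have : 0 ≤ v ^ γ := by positivity
      linarith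

lemma IsAdmissibleKernel.pos {γ : ℝ} {K : ℝ → ℝ → ℝ} (hK : IsAdmissibleKernel γ K)
    {v v' : ℝ} (hv : 0 < v) (hvv' : v < v') : 0 < K v v' := by
  obtain ⟨-, -, h, g, -, -, hKhg, -, -, hloc, -, -, -, G₀, G₁, k, hG₀, -, hk, hg⟩ := hK
  have hv' : 0 < v' := hv.trans hvv'
  have hx : v / (v + v') ∈ Icc (0:ℝ) 1 :=
    ⟨by positivity, (div_le_one (by positivity)).2 (by linarith)⟩
  have hx2 : v / (v + v') < 1 / 2 := by rw [div_lt_div_iff₀] <;> linarith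
  have hg' : 0 < g (v / (v + v')) := by
    refine lt_of_lt_of_le ?_ (hg _ hx).1
    have : 0 < |v / (v + v') - 1 / 2| := abs_pos.2 (by linarith)
    positivity
  obtain ⟨C, hC, hle⟩ := hloc (max v' (1 / v)) (lt_max_of_lt_left hv')
  have hl : 1 / max v' (1 / v) ≤ v := by
    rw [one_div_le (lt_max_of_lt_left hv') hv]; exact le_max_right _ _
  have hr : v' ≤ max v' (1 / v) := le_max_left _ _
  have hh : 0 < h v v' := hC.trans_le
    (hle v ⟨hl, hvv'.le.trans hr⟩ v' ⟨hl.trans hvv'.le, hr⟩)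
  rw [hKhg v v' hv.le hv'.le (by positivity)]
  exact mul_pos hh hg'

/-! ### Solutions with a non-Dirac datum have no bounded support -/

/-- Only pairs with `v ≤ v₀` and `w > a` are kept: there `4 v ≤ w`, and the excess is exactly `v`.
-/
lemma lintegral_rate_mul_excess_ge {γ b H : ℝ} {K : ℝ → ℝ → ℝ} (hγ : 0 ≤ γ) (hb : 0 ≤ b)
    (hlow : ∀ v v', 0 < v → 4 * v ≤ v' → H < v' → b * v' ^ γ ≤ K v v')
    {v₀ a : ℝ} (hv₀ : 0 < v₀) (hva : 4 * v₀ ≤ a) (hHa : H ≤ a) (μ : Measure ℝ) [SFinite μ] :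
    ENNReal.ofReal (b * a ^ γ) * (∫⁻ v in Iic v₀, ENNReal.ofReal v ∂μ) * μ (Ioi a) ≤
      ∫⁻ p, rate K p * ENNReal.ofReal (excess a p) ∂(μ.prod μ) := by
  have hle : ∀ p : ℝ × ℝ, ENNReal.ofReal (b * a ^ γ) *
      ((Iic v₀).indicator ENNReal.ofReal p.1 * (Ioi a).indicator 1 p.2) ≤
      rate K p * ENNReal.ofReal (excess a p) := by
    rintro ⟨v, w⟩
    by_cases hv : v ∈ Iic v₀
    swap
    · simp [hv]
    by_cases hw : w ∈ Ioi a
    swap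
    · simp [hw]
    have hv1 : v ≤ v₀ := hv
    have hw1 : a < w := hw
    rcases le_or_gt v 0 with h0 | h0
    · simp [hv1, ENNReal.ofReal_of_nonpos h0]
    have hw0 : 0 < w := by linarith
    rw [rate_of_pos K h0 hw0, excess_eq h0.le (by linarith) hw1.le, indicator_of_mem hv,
      indicator_of_mem hw, Pi.one_apply, mul_one]
    gcongr
    refine le_trans ?_ (hlow v w h0 (by linarith) (by linarith))
    have : 0 ≤ a := by linarith
    gcongr
  refine le_trans (le_of_eq ?_) (lintegral_mono hle)
  rw [lintegral_const_mul _ (by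
      refine Measurable.mul ?_ ?_
      · exact (ENNReal.measurable_ofReal.indicator measurableSet_Iic).comp measurable_fst
      · exact (measurable_one.indicator measurableSet_Ioi).comp measurable_snd),
    lintegral_prod_mul (ENNReal.measurable_ofReal.indicator measurableSet_Iic).aemeasurable
      (measurable_one.indicator measurableSet_Ioi).aemeasurable,
    lintegral_indicator measurableSet_Iic, lintegral_indicator_one measurableSet_Ioi, mul_assoc]

/-- Chebyshev: the mass above `v₀` is at most `C v₀^(1-γ)`, which falls below `m` for a `v₀`
depending on `C` and `m` alone, hence uniform in time. -/
lemma exists_setLIntegral_Iic_ge {γ : ℝ} (hγ : 1 < γ) (C : NNReal) {m : ℝ} (hm : 0 < m) :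
    ∃ v₀ : ℝ, 0 < v₀ ∧ ∀ μ : Measure ℝ, weightedMoment γ μ ≤ C → mass μ = ENNReal.ofReal (m + m) →
      ENNReal.ofReal m ≤ ∫⁻ v in Iic v₀, ENNReal.ofReal v ∂μ := by
  have h1 : Tendsto (fun A : ℝ => A ^ (1 - γ)) atTop (𝓝 0) := by
    simpa using tendsto_rpow_neg_atTop (y := γ - 1) (by linarith)
  have h2 := h1.mul_const (C : ℝ)
  rw [zero_mul] at h2
  obtain ⟨v₀, hv, hv₀⟩ := ((h2.eventually_lt_const hm).and (eventually_gt_atTop 0)).exists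
  refine ⟨v₀, hv₀, fun μ hμ hmass => ?_⟩
  have hout : ∫⁻ v in Ioi v₀, ENNReal.ofReal v ∂μ ≤ ENNReal.ofReal m := by
    calc _ ≤ ENNReal.ofReal (v₀ ^ (1 - γ)) * weightedMoment γ μ := setLIntegral_Ioi_le hγ.le hv₀ μ
      _ ≤ ENNReal.ofReal (v₀ ^ (1 - γ)) * C := by gcongr
      _ = ENNReal.ofReal (v₀ ^ (1 - γ) * C) := by
        rw [ENNReal.ofReal_mul (by positivity), ENNReal.ofReal_coe_nnreal]
      _ ≤ _ := ENNReal.ofReal_le_ofReal hv.le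
  have hsplit := lintegral_add_compl (μ := μ) (fun v => ENNReal.ofReal v) (measurableSet_Iic (a := v₀))
  rw [compl_Iic] at hsplit
  change _ = mass μ at hsplit
  rw [hmass, ENNReal.ofReal_add hm.le hm.le] at hsplit
  by_contra! hn
  exact absurd hsplit (ENNReal.add_lt_add_of_lt_of_le (ne_top_of_le_ne_top (by finiteness) hout)
    hn hout).ne

lemma IsBalanced.exists_tail_eq_zero {γ b H τ m : ℝ} {K : ℝ → ℝ → ℝ} {κ : Kernel ℝ ℝ}
    [IsFiniteKernel κ] (hB : IsBalanced (rate K) κ τ) (hγ : 1 < γ) (hb : 0 < b)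
    (hlow : ∀ v v', 0 < v → 4 * v ≤ v' → H < v' → b * v' ^ γ ≤ K v v') (hτ : 0 < τ)
    {C : NNReal} (hC : ∀ t ∈ Icc 0 τ, weightedMoment γ (κ t) ≤ C) (hm : 0 < m)
    (hmass : ∀ t ∈ Icc 0 τ, mass (κ t) = ENNReal.ofReal (m + m)) :
    ∃ A₁ : ℝ, ∀ A, A₁ ≤ A → tail (κ (τ / 2)) A = 0 := by
  obtain ⟨v₀, hv₀, hsmall⟩ := exists_setLIntegral_Iic_ge hγ C hm
  obtain ⟨L, hL⟩ := hB.collisions_le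
  have htop : ∀ t ∈ Icc 0 τ, ∀ a, 0 ≤ a → tail (κ t) a ≠ ⊤ := fun t ht a ha =>
    ne_top_of_le_ne_top (by rw [hmass t ht]; finiteness) (tail_le_mass _ ha)
  obtain ⟨A₁, hA₁⟩ := exists_nonpos_of_transport (D := fun a t => (tail (κ t) a).toReal) (γ := γ)
    (b := b * m / 2) (A₀ := max (4 * v₀) H) (C₀ := C) (L := L) (τ := τ) hγ (by positivity) hτ
    (by
      intro A a t h hA₀ hA hAa ht hh hth
      have hva : 4 * v₀ ≤ a := (le_max_left _ _).trans (hA₀.trans hAa)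
      have hHa : H ≤ a := (le_max_right _ _).trans (hA₀.trans hAa)
      have ha : 0 < a := hA.trans_le hAa
      have ht' : t ∈ Icc 0 τ := ⟨ht, by linarith⟩
      have hth' : t + h ∈ Icc 0 τ := ⟨by linarith, hth⟩
      have hσ0 : 0 ≤ b * m / 2 * A ^ γ := by positivity
      set F : ℝ := (κ (t + h)).real (Ioi a) with hF
      -- On `(t, t + h]` the number of particles above `a` is replaced by its final value `F` at
      -- cost `L h`, the source of the quadratic error. The final value is needed because the
      -- first-order gain must cancel the cost `F · (bm/2) A^γ h` of shifting the level at time `t +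
      -- h`.
      have hgain : ENNReal.ofReal (b * A ^ γ * m * (F - L * h) * h) ≤
          ∫⁻ p, ENNReal.ofReal (excess a p) ∂(collisions (rate K) κ t (t + h)) := by
        rw [lintegral_collisions hB.measurable_rate (measurable_ofReal_excess a)]
        have hr : ∀ r ∈ Ioc t (t + h), ENNReal.ofReal (b * A ^ γ * m * (F - L * h)) ≤
            ∫⁻ p, rate K p * ENNReal.ofReal (excess a p) ∂((κ r).prod (κ r)) := by
          intro r hr
          have hr' : r ∈ Icc 0 τ := ⟨ht.trans hr.1.le, hr.2.trans hth⟩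
          refine le_trans ?_ (lintegral_rate_mul_excess_ge (by linarith) hb.le hlow hv₀ hva hHa _)
          have h1 := (hB.measure_balance_le hL hr'.1 hr.2 hth (measurableSet_Ioi (a := a))).1
          have h2 : ENNReal.ofReal (F - L * h) ≤ κ r (Ioi a) := by
            refine ENNReal.ofReal_le_of_le_toReal ?_
            have h3 := ENNReal.toReal_mono (by finiteness) h1
            rw [ENNReal.toReal_add (by finiteness) (by finiteness), ENNReal.toReal_mul,
              ENNReal.toReal_ofReal (by linarith [hr.2])] at h3
            have h4 : (L : ℝ) * (t + h - r) ≤ L * h :=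
              mul_le_mul_of_nonneg_left (by linarith [hr.1]) L.2
            change F ≤ _ at h3
            change F - L * h ≤ _
            simp only [ENNReal.coe_toReal] at h3
            linarith
          rw [ENNReal.ofReal_mul (by positivity), ENNReal.ofReal_mul (by positivity)]
          have h5 : b * A ^ γ ≤ b * a ^ γ := by gcongr
          gcongr
          exact hsmall _ (hC r hr') (hmass r hr')
        refine le_trans (le_of_eq ?_) (setLIntegral_mono' measurableSet_Ioc hr)
        rw [setLIntegral_const, Real.volume_Ioc, ENNReal.ofReal_mul' hh]
        simp
      have hbal := hB.tail_balance (M := ENNReal.ofReal (m + m)) (by finiteness) hmass ht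
        (by linarith : t ≤ t + h) hth ha.le
      have h1 : (tail (κ t) a).toReal + (b * m / 2 * A ^ γ) * (F - L * h) * h ≤
          (tail (κ (t + h)) a).toReal := by
        have hle : tail (κ t) a + tail (κ t) a + ENNReal.ofReal (b * A ^ γ * m * (F - L * h) * h) ≤
            tail (κ (t + h)) a + tail (κ (t + h)) a := by rw [hbal]; gcongr
        have n1 := htop t ht' a ha.le
        have n2 := htop _ hth' a ha.le
        have h3 := ENNReal.toReal_mono (by finiteness) hle
        rw [ENNReal.toReal_add (by finiteness) (by finiteness),
          ENNReal.toReal_add (by finiteness) (by finiteness),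
          ENNReal.toReal_add (by finiteness) (by finiteness), ENNReal.toReal_ofReal'] at h3
        have h4 := (le_max_left (b * A ^ γ * m * (F - L * h) * h) 0)
        linarith
      have h2 : (tail (κ (t + h)) a).toReal ≤
          (tail (κ (t + h)) (a + b * m / 2 * A ^ γ * h)).toReal + b * m / 2 * A ^ γ * h * F := by
        have n2 := htop _ hth' (a + b * m / 2 * A ^ γ * h) (by positivity)
        have h3 := ENNReal.toReal_mono (by finiteness)
          (tail_le_tail_add (κ (t + h)) a (b * m / 2 * A ^ γ * h))
        rwa [ENNReal.toReal_add (by finiteness) (by finiteness), ENNReal.toReal_mul,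
          ENNReal.toReal_ofReal (by positivity)] at h3
      change (tail (κ t) a).toReal - _ ≤ (tail (κ (t + h)) (a + b * m / 2 * A ^ γ * h)).toReal
      linarith)
    (by
      intro a t ha ht
      have h1 := (tail_le hγ.le ha (κ t)).trans (mul_le_mul_right (hC t ht) _)
      have h2 := ENNReal.toReal_mono (by finiteness) h1
      rw [ENNReal.toReal_mul, ENNReal.toReal_ofReal (by positivity), ENNReal.coe_toReal] at h2
      change (tail (κ t) a).toReal ≤ _
      linarith)
  refine ⟨max A₁ 0, fun A hA => ?_⟩
  have h1 := hA₁ A ((le_max_left _ _).trans hA)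
  have h2 := htop (τ / 2) ⟨by linarith, by linarith⟩ A ((le_max_right _ _).trans hA)
  exact ((ENNReal.toReal_eq_zero_iff _).1 (le_antisymm h1 ENNReal.toReal_nonneg)).resolve_right h2

/-! ### Unbounded support at positive times -/

lemma exists_measure_Icc_pos {μ : Measure ℝ} [IsFiniteMeasure μ] (hμ : IsRadonPos μ) (h0 : μ ≠ 0)
    (hd : ∀ M V : ℝ, 0 < M → 0 < V → μ ≠ ENNReal.ofReal M • Measure.dirac V) :
    ∃ α β : ℝ, 0 < α ∧ 0 < μ (Icc α β) ∧ 0 < μ (Ioi β) := by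
  by_cases hsub : (μ.support ∩ Ioi 0).Subsingleton
  · exfalso
    have hae : ∀ᵐ v ∂μ, v ∈ μ.support ∩ Ioi 0 := by
      filter_upwards [Measure.support_mem_ae (μ := μ), hμ.ae_pos] with v h1 h2 using ⟨h1, h2⟩
    have hne : NeZero μ := ⟨h0⟩
    obtain ⟨V, hV⟩ := hae.exists
    have hae' : ∀ᵐ v ∂μ, v = V := hae.mono fun v hv => hsub hv hV
    have hμV : μ = μ univ • Measure.dirac V := by
      ext A hA
      rw [Measure.smul_apply, Measure.dirac_apply' _ hA, smul_eq_mul]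
      by_cases hVA : V ∈ A
      · rw [indicator_of_mem hVA, Pi.one_apply, mul_one]
        refine measure_congr ?_
        filter_upwards [hae'] with v hv
        exact propext ⟨fun _ => mem_univ v, fun _ => by rw [hv]; exact hVA⟩
      · rw [indicator_of_notMem hVA, mul_zero]
        refine measure_mono_null (fun v hv => ?_) (ae_iff.1 hae')
        rintro rfl
        exact hVA hv
    refine hd (μ.real univ) V ?_ hV.2 ?_
    · exact ENNReal.toReal_pos (by simpa using h0) (measure_ne_top _ _)
    · rw [ofReal_measureReal]; exact hμV
  -- Two positive points `x < y` of the support are separated by their midpoint `β`.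
  · rw [not_subsingleton_iff] at hsub
    obtain ⟨x, hx, y, hy, hxy⟩ := hsub
    wlog hlt : x < y generalizing x y
    · exact this y hy x hx hxy.symm (lt_of_le_of_ne (not_lt.1 hlt) hxy.symm)
    have hx0 : 0 < x := hx.2
    exact ⟨x / 2, (x + y) / 2, by linarith,
      (Measure.mem_support_iff_forall x).1 hx.1 _ (Icc_mem_nhds (by linarith) (by linarith)),
      (Measure.mem_support_iff_forall y).1 hy.1 _ (Ioi_mem_nhds (by linarith))⟩

lemma IsBalanced.tail_mono {k : ℝ × ℝ → ℝ≥0∞} {κ : Kernel ℝ ℝ} {τ : ℝ} (hB : IsBalanced k κ τ)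
    {M : ℝ≥0∞} (hM : M ≠ ⊤) (hmass : ∀ t ∈ Icc 0 τ, mass (κ t) = M) {s t : ℝ} (hs : 0 ≤ s)
    (hst : s ≤ t) (ht : t ≤ τ) {A : ℝ} (hA : 0 ≤ A) : tail (κ s) A ≤ tail (κ t) A := by
  by_contra! hn
  have h := hB.tail_balance hM hmass hs hst ht hA
  have h2 := ENNReal.add_lt_add hn hn
  rw [h] at h2
  exact absurd h2 (not_lt.2 le_self_add)

/-- For a short time particles remain in `[α, β]`, and each collision of one of them with a particle
above `β + nα` produces one above `β + (n+1)α`. Induction on `n` reaches every level at arbitrarily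
small times, and monotonicity of the tail covers later ones. -/
lemma IsBalanced.tail_pos {τ : ℝ} {K : ℝ → ℝ → ℝ} {κ : Kernel ℝ ℝ} [IsFiniteKernel κ]
    (hB : IsBalanced (rate K) κ τ) (hpos : ∀ v v', 0 < v → v < v' → 0 < K v v')
    {M : ℝ≥0∞} (hM : M ≠ ⊤) (hmass : ∀ t ∈ Icc 0 τ, mass (κ t) = M)
    {α β : ℝ} (hα : 0 < α) (hαβ : 0 < κ 0 (Icc α β)) (hβ : 0 < κ 0 (Ioi β)) :
    ∀ t ∈ Ioc 0 τ, ∀ A, 0 < tail (κ t) A := by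
  obtain ⟨L, hL⟩ := hB.collisions_le
  have hαβ' : α ≤ β := by
    by_contra! h
    simp [Icc_eq_empty_of_lt h] at hαβ
  have hm : 0 < (κ 0).real (Icc α β) := ENNReal.toReal_pos hαβ.ne' (measure_ne_top _ _)
  -- By the Lipschitz bound `[α, β]` cannot empty before time `κ₀([α, β]) / L`; `L + 1` avoids
  -- division by zero and makes the inequality strict.
  have hI : ∀ t, 0 ≤ t → t ≤ (κ 0).real (Icc α β) / (L + 1) → t ≤ τ → 0 < κ t (Icc α β) := by
    intro t ht ht1 htτ
    rw [pos_iff_ne_zero]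
    intro h0
    have h1 := (hB.measure_balance_le hL le_rfl ht htτ (measurableSet_Icc (a := α) (b := β))).2
    rw [h0, zero_add] at h1
    have h2 := ENNReal.toReal_mono (by finiteness) h1
    rw [ENNReal.toReal_mul, ENNReal.toReal_ofReal (by linarith), ENNReal.coe_toReal, sub_zero] at h2
    change (κ 0).real (Icc α β) ≤ _ at h2
    rw [le_div_iff₀ (by positivity)] at ht1
    have : t = 0 := by linarith
    subst this
    linarith
  have hstep : ∀ n : ℕ, ∀ t, 0 < t → t ≤ (κ 0).real (Icc α β) / (L + 1) → t ≤ τ →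
      0 < tail (κ t) (β + n * α) := by
    intro n
    induction n with
    | zero =>
      intro t ht _ htτ
      have := (tail_pos_iff.2 hβ).trans_le
        (hB.tail_mono hM hmass le_rfl ht.le htτ (by linarith : 0 ≤ β))
      simpa using this
    | succ n ih =>
      intro t ht ht1 htτ
      set A : ℝ := β + n * α with hA
      have hβA : β ≤ A := by
        have : 0 ≤ n * α := by positivity
        linarith
      have hA0 : 0 < A := by linarith
      have e : β + ((n + 1 : ℕ) : ℝ) * α = A + α := by push_cast; rw [hA]; ring
      rw [e, pos_iff_ne_zero]
      intro h0
      -- A zero tail at time `t` forces zero total excess on `(0, t]`, hence at almost every `r`;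
      -- one such `r` contradicts the induction hypothesis.
      have hbal := hB.tail_balance hM hmass le_rfl ht.le htτ (by linarith : 0 ≤ A + α)
      rw [h0, add_zero] at hbal
      have hz := (add_eq_zero.1 hbal.symm).2
      have hms : Measurable fun p => rate K p * ENNReal.ofReal (excess (A + α) p) :=
        hB.measurable_rate.mul (measurable_ofReal_excess (A + α))
      have hmr : Measurable fun r =>
          ∫⁻ p, rate K p * ENNReal.ofReal (excess (A + α) p) ∂((κ r).prod (κ r)) := by
        have := hms.lintegral_kernel (κ := κ ×ₖ κ)
        simpa only [Kernel.prod_apply] using this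
      rw [lintegral_collisions hB.measurable_rate (measurable_ofReal_excess _),
        lintegral_eq_zero_iff hmr] at hz
      have hvol : NeZero (volume.restrict (Ioc 0 t)) := ⟨by simp [Measure.restrict_eq_zero, ht]⟩
      obtain ⟨r, hr, hr'⟩ := (hz.and (ae_restrict_mem measurableSet_Ioc)).exists
      have hrt : r ≤ (κ 0).real (Icc α β) / (L + 1) := hr'.2.trans ht1
      have h1 := hI r hr'.1.le hrt (hr'.2.trans htτ)
      have h2 := tail_pos_iff.1 (ih r hr'.1 hrt (hr'.2.trans htτ))
      have hr0 : ∫⁻ p, rate K p * ENNReal.ofReal (excess (A + α) p) ∂((κ r).prod (κ r)) = 0 := hr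
      rw [lintegral_eq_zero_iff hms] at hr0
      have hprod : ((κ r).prod (κ r)) (Icc α β ×ˢ Ioi A) = 0 := by
        refine measure_mono_null (fun p hp => ?_) (ae_iff.1 hr0)
        obtain ⟨v, w⟩ := p
        have hv : v ∈ Icc α β := hp.1
        have hw : A < w := hp.2
        have hv0 : 0 < v := hα.trans_le hv.1
        have hvw : v < w := hv.2.trans_lt (hβA.trans_lt hw)
        have hx : 0 < rate K (v, w) * ENNReal.ofReal (excess (A + α) (v, w)) := by
          rw [rate_of_pos K hv0 (hv0.trans hvw)]
          exact ENNReal.mul_pos (ENNReal.ofReal_pos.2 (hpos v w hv0 hvw)).ne'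
            (ENNReal.ofReal_pos.2 (excess_pos hα hA0 hv.1 hw)).ne'
        exact hx.ne'
      rw [Measure.prod_prod] at hprod
      exact (mul_eq_zero.1 hprod).elim h1.ne' h2.ne'
  intro t ht A
  set t₁ : ℝ := min t ((κ 0).real (Icc α β) / (L + 1)) with ht₁
  have ht₁0 : 0 < t₁ := lt_min ht.1 (by positivity)
  have ht₁t : t₁ ≤ t := min_le_left _ _
  obtain ⟨n, hn⟩ := exists_nat_gt ((A - β) / α)
  rw [div_lt_iff₀ hα] at hn
  have hn0 : 0 ≤ n * α := by positivity
  calc 0 < tail (κ t₁) (β + n * α) := hstep n t₁ ht₁0 (min_le_right _ _) (ht₁t.trans ht.2)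
    _ ≤ tail (κ t) (β + n * α) :=
      hB.tail_mono hM hmass ht₁0.le ht₁t ht.2 (by linarith)
    _ ≤ tail (κ t) A := lintegral_mono fun v => ENNReal.ofReal_le_ofReal (by linarith)

end Coagulation

/-! ### The contradiction at time `τ / 2` -/

theorem theorem1p6 (γ : ℝ) (K : ℝ → ℝ → ℝ) (hK : Coagulation.IsAdmissibleKernel γ K)
    (fin : MeasureTheory.Measure ℝ) (hfin : Coagulation.IsRadonPos fin) (hfin_ne_zero : fin ≠ 0)
    (hfin_not_dirac : ∀ M V : ℝ, 0 < M → 0 < V →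
      fin ≠ ENNReal.ofReal M • MeasureTheory.Measure.dirac V)
    (T : EReal) (hT : 0 < T) :
    ¬ ∃ f : ℝ → MeasureTheory.Measure ℝ,
      Coagulation.IsMassConservingSolution γ K fin T f := by
  open Coagulation in
  rintro ⟨f, hf⟩
  obtain ⟨τ, hτ0, hτT⟩ : ∃ τ : ℝ, 0 < τ ∧ (τ : EReal) ≤ T := by
    obtain ⟨τ, h1, h2⟩ := EReal.lt_iff_exists_real_btwn.1 hT
    exact ⟨τ, by exact_mod_cast h1, h2.le⟩
  have hsub : ∀ {t}, t ∈ Icc 0 τ → t ∈ timeInterval T := fun ht =>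
    ⟨ht.1, (EReal.coe_le_coe_iff.2 ht.2).trans hτT⟩
  have hf0 : f 0 = fin := by
    have h0 := hsub (left_mem_Icc.2 hτ0.le)
    refine (hf.radon 0 h0).ext_of_integral_eq hfin fun φ hφ => ?_
    have := hf.weak_formulation φ hφ 0 h0
    rw [intervalIntegral.integral_same] at this
    linarith
  obtain ⟨C, hC⟩ := hf.moment_bound
  obtain ⟨C₁, hC₁, hbound⟩ := hK.exists_le
  obtain ⟨b, H, hb, -, hlow⟩ := hK.exists_ge
  obtain ⟨κ, hκfin, hκ, hB⟩ := exists_isBalanced hC₁ hK.continuousOn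
    (fun v v' hv hv' => hK.2.1 v v' hv.le hv'.le) hbound hf.toIsWeakSolution hτT
  have hκ0 : κ 0 = fin := (hκ 0 (left_mem_Icc.2 hτ0.le)).trans hf0
  have hfinfin : IsFiniteMeasure fin := hκ0 ▸ inferInstance
  have hmass : ∀ t ∈ Icc 0 τ, mass (κ t) = mass fin := fun t ht => by
    rw [hκ t ht]; exact hf.mass_conserved t (hsub ht)
  have hCκ : ∀ t ∈ Icc 0 τ, weightedMoment γ (κ t) ≤ C := fun t ht => by
    rw [hκ t ht]; exact hC t (hsub ht)
  -- Finite mass follows from `v ≤ 1 + v^γ` and the moment bound at time `0`.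
  have hMtop : mass fin ≠ ⊤ := by
    have h1 : mass fin ≤ fin univ + weightedMoment γ fin := by
      rw [← lintegral_one, weightedMoment, ← lintegral_add_left measurable_const, mass]
      refine lintegral_mono_ae ?_
      filter_upwards [hfin.ae_pos] with v hv
      rw [← ENNReal.ofReal_one, ← ENNReal.ofReal_add zero_le_one (by positivity)]
      refine ENNReal.ofReal_le_ofReal ?_
      rcases le_total v 1 with h | h
      · have : 0 ≤ v ^ γ := by positivity
        linarith
      · have := Real.self_le_rpow_of_one_le h hK.1.le
        linarith
    have h2 := hCκ 0 (left_mem_Icc.2 hτ0.le)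
    rw [hκ0] at h2
    exact ne_top_of_le_ne_top (by finiteness) (h1.trans (add_le_add_right h2 _))
  have hMpos : mass fin ≠ 0 := by
    intro h
    rw [mass, lintegral_eq_zero_iff (by fun_prop)] at h
    have hF : ∀ᵐ v ∂fin, False := by
      filter_upwards [h, hfin.ae_pos] with v h1 h2
      exact (ENNReal.ofReal_pos.2 h2).ne' h1
    exact hfin_ne_zero (ae_eq_bot.1 (Filter.eventually_false_iff_eq_bot.1 hF))
  set m : ℝ := (mass fin).toReal / 2 with hm
  have hm0 : 0 < m := half_pos (ENNReal.toReal_pos hMpos hMtop)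
  have hmm : mass fin = ENNReal.ofReal (m + m) := by
    rw [hm, add_halves, ENNReal.ofReal_toReal hMtop]
  obtain ⟨α, β, hα, hαβ, hβ⟩ := exists_measure_Icc_pos hfin hfin_ne_zero hfin_not_dirac
  obtain ⟨A, hA⟩ := hB.exists_tail_eq_zero hK.1 hb hlow hτ0 hCκ hm0
    fun t ht => (hmass t ht).trans hmm
  exact (hB.tail_pos (fun v v' hv hvv' => hK.pos hv hvv') hMtop hmass hα (by rwa [hκ0])
    (by rwa [hκ0]) (τ / 2) ⟨half_pos hτ0, half_le_self hτ0.le⟩ A).ne' (hA A le_rfl)
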